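/- Let $c:\mathbb R\times\mathbb R\to\mathbb R$ be non-negative and lower semicontinuous, and let $\eta,\nu$ be Borel probability measures on $\mathbb R$. **Adapted couplings.** Let $\mathrm{Cpl}_a(\eta,\nu)$ be the class of all $(X,Y,(\Omega,\mathcal A,\mathbb P))$, where $X,Y$ are real random variables with laws $\eta$ and $\nu$ on a complete probability space $(\Omega,\mathcal A,\mathbb P)$, for which there are real random variables $\tau,Z$ on $\Omega$ with $Z\ge 0$ a.s. and $$Y=(X+Z)\mathbf 1_{\{X\le\tau\}}+\tau\mathbf 1_{\{X>\tau\}}\quad\text{a.s.},$$ such that for every $t\in\mathbb R$ with $\mathbb P(X\ge t)>0$ and all Borel sets $A\subset(-\infty,t)$, $B\subset[t,\infty)$, $$\mathbb P(\tau\in A,\,X\in B\mid X\ge t)=\mathbb P(\tau\in A\mid X\ge t)\,\mathbb P(X\in B\mid X\ge t).$$ **Causal plans.** For $t\in\mathbb R$ let $\mathcal B_t$ be the $\sigma$-field of Borel sets $A\subset\mathbb R$ with $A\subset(-\infty,t)$ or $[t,\infty)\subset A$. For a $\sigma$-field $\mathcal G$ of Borel sets let $\mathcal G^\eta$ be the $\sigma$-field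 generated by $\mathcal G$ and all subsets of Borel $\eta$-null sets. Let $\Pi(\eta,\nu)$ be the set of Borel probability measures on $\mathbb R\times\mathbb R$ with marginals $\eta$ and $\nu$. For $\gamma\in\Pi(\eta,\nu)$ let $Q_\gamma$ be a Markov kernel with $\gamma(A\times B)=\int_A Q_\gamma^x(B)\,\eta(dx)$ for all Borel $A,B$ (it is unique up to an $\eta$-null set), and put $$\mathcal G_t(\gamma)=\sigma\big(x\mapsto Q_\gamma^x(B)\,:\,B\in\mathcal B_t,\ \nu(\partial B)=0\big)^\eta .$$ Let $\Pi_c(\eta,\nu)$ be the set of $\gamma\in\Pi(\eta,\nu)$ with $\mathcal G_t(\gamma)\subset\mathcal B_t^\eta$ for all $t\in\mathbb R$. Expectations and integrals of $c$ take values in $[0,+\infty]$. Then the infimum $$\inf\{E_{\mathbb P}[c(X,Y)]\,:\,(X,Y,(\Omega,\mathcal A,\mathbb P))\in \mathrm{Cpl}_a(\eta,\nu)\}\tag{1}$$ is attained by some adapted coupling in $\mathrm{Cpl}_a(\eta,\nu)$. Moreover, this problem is equivalent to the causal Monge–Kantorovich problem $$\inf_{\gamma\in\Pi_c(\eta,\nu)}\int_{\mathbb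 R\times\mathbb R}c(x,y)\,\gamma(dx,dy):\tag{2}$$ the values of (1) and (2) are equal, and a Borel measure $\gamma$ on $\mathbb R\times\mathbb R$ belongs to $\Pi_c(\eta,\nu)$ and attains (2) if and only if $\gamma$ is the joint law of $(X,Y)$ for some $(X,Y,(\Omega,\mathcal A,\mathbb P))\in \mathrm{Cpl}_a(\eta,\nu)$ that attains (1). -/

import Mathlib

open MeasureTheory ProbabilityTheory Set

universe u

/-- `(X, Y)`, defined on the probability space `(Ω, P)`, is an adapted coupling: up to null sets
`Y = (X + Z) 1_{X ≤ τ} + τ 1_{X > τ}` for a delay `Z ≥ 0` and a waiting time `τ` such that,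
conditionally on `{X ≥ t}`, the events `{τ ∈ A}` and `{X ∈ B}` are independent for all Borel
sets `A ⊆ (-∞, t)` and `B ⊆ [t, ∞)`. -/
def IsAdaptedCoupling {Ω : Type u} [MeasurableSpace Ω] (P : Measure Ω) (X Y : Ω → ℝ) : Prop :=
  Measurable X ∧ Measurable Y ∧
    ∃ τ Z : Ω → ℝ, Measurable τ ∧ Measurable Z ∧
      (∀ᵐ ω ∂P, Y ω =
        {ω | X ω ≤ τ ω}.indicator (fun ω => X ω + Z ω) ω + {ω | τ ω < X ω}.indicator τ ω) ∧
      (∀ᵐ ω ∂P, 0 ≤ Z ω) ∧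
      ∀ t : ℝ, 0 < P {ω | t ≤ X ω} →
        ∀ A B : Set ℝ, MeasurableSet A → MeasurableSet B → A ⊆ Iio t → B ⊆ Ici t →
          cond P {ω | t ≤ X ω} (τ ⁻¹' A ∩ X ⁻¹' B) =
            cond P {ω | t ≤ X ω} (τ ⁻¹' A) * cond P {ω | t ≤ X ω} (X ⁻¹' B)

/-- The adapted couplings of `η` and `ν`, each with its own complete probability space. -/
structure AdaptedCoupling (η ν : Measure ℝ) where
  Ω : Type u
  [measurableSpace : MeasurableSpace Ω]
  P : Measure Ω
  [isProbabilityMeasure : IsProbabilityMeasure P]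
  [isComplete : P.IsComplete]
  X : Ω → ℝ
  Y : Ω → ℝ
  isAdaptedCoupling : IsAdaptedCoupling P X Y
  law_X : P.map X = η
  law_Y : P.map Y = ν

namespace AdaptedCoupling

attribute [instance] measurableSpace isProbabilityMeasure isComplete

variable {η ν : Measure ℝ}

/-- The joint law of `X` and `Y`. -/
noncomputable def jointLaw (C : AdaptedCoupling.{u} η ν) : Measure (ℝ × ℝ) :=
  C.P.map (fun ω => (C.X ω, C.Y ω))

/-- The expected cost `E[c(X, Y)] ∈ [0, ∞]`, for a non-negative cost function `c`. -/
noncomputable def cost (C : AdaptedCoupling.{u} η ν) (c : ℝ × ℝ → ℝ) : ENNReal :=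
  ∫⁻ ω, ENNReal.ofReal (c (C.X ω, C.Y ω)) ∂C.P

end AdaptedCoupling

/-- The `σ`-field of the Borel sets `A` with `A ⊆ (-∞, t)` or `[t, ∞) ⊆ A`. -/
@[reducible]
def borelBefore (t : ℝ) : MeasurableSpace ℝ where
  MeasurableSet' A := MeasurableSet A ∧ (A ⊆ Iio t ∨ Ici t ⊆ A)
  measurableSet_empty := ⟨MeasurableSet.empty, Or.inl (empty_subset _)⟩
  measurableSet_compl A := by
    rintro ⟨hA, h | h⟩
    · refine ⟨hA.compl, Or.inr fun x hx hxA => ?_⟩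
      exact absurd (mem_Iio.mp (h hxA)) (not_lt.mpr (mem_Ici.mp hx))
    · refine ⟨hA.compl, Or.inl fun x hx => ?_⟩
      exact mem_Iio.mpr (not_le.mp fun hxt => hx (h (mem_Ici.mpr hxt)))
  measurableSet_iUnion f hf := by
    refine ⟨MeasurableSet.iUnion fun i => (hf i).1, ?_⟩
    by_cases h : ∃ i, Ici t ⊆ f i
    · obtain ⟨i, hi⟩ := h
      exact Or.inr (hi.trans (subset_iUnion f i))
    · refine Or.inl (iUnion_subset fun i => ?_)
      exact (hf i).2.resolve_right fun hi => h ⟨i, hi⟩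

/-- The subsets of Borel null sets of `η`. -/
def negligibleSets (η : Measure ℝ) : Set (Set ℝ) :=
  {N | ∃ A, MeasurableSet A ∧ N ⊆ A ∧ η A = 0}

/-- The smallest `σ`-field that contains `m` and all `η`-negligible sets. -/
@[reducible]
def completedBy (η : Measure ℝ) (m : MeasurableSpace ℝ) : MeasurableSpace ℝ :=
  m ⊔ MeasurableSpace.generateFrom (negligibleSets η)

/-- The transport plans from `η` to `ν`. -/
def transportPlans (η ν : Measure ℝ) : Set (Measure (ℝ × ℝ)) :=
  {γ | IsProbabilityMeasure γ ∧ γ.map Prod.fst = η ∧ γ.map Prod.snd = ν}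

/-- `Q` is a transport kernel of a plan `γ` with first marginal `η`. -/
def IsTransportKernel (η : Measure ℝ) (γ : Measure (ℝ × ℝ)) (Q : Kernel ℝ ℝ) : Prop :=
  IsMarkovKernel Q ∧
    ∀ A B : Set ℝ, MeasurableSet A → MeasurableSet B → γ (A ×ˢ B) = ∫⁻ x in A, Q x B ∂η

/-- The `σ`-field at time `t` of the filtration generated by a plan from `η` to `ν` with transport
kernel `Q`: the `η`-completion of the `σ`-field generated by the maps `x ↦ Q x B`, for `B` in the
`σ`-field `borelBefore t` with `ν (∂B) = 0`. -/
@[reducible]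
def planFiltration (η ν : Measure ℝ) (Q : Kernel ℝ ℝ) (t : ℝ) : MeasurableSpace ℝ :=
  completedBy η
    (⨆ B ∈ {B : Set ℝ | MeasurableSet[borelBefore t] B ∧ ν (frontier B) = 0},
      MeasurableSpace.comap (fun x => Q x B) inferInstance)

/-- The causal transport plans from `η` to `ν`. Two transport kernels of `γ` agree `η`-almost
everywhere, so that, by the completion, the generated filtration depends on `γ` only. -/
def causalPlans (η ν : Measure ℝ) : Set (Measure (ℝ × ℝ)) :=
  {γ | γ ∈ transportPlans η ν ∧
    ∃ Q : Kernel ℝ ℝ, IsTransportKernel η γ Q ∧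
      ∀ t : ℝ, planFiltration η ν Q t ≤ completedBy η (borelBefore t)}

open Filter Topology

/-! Both problems range over the same joint laws. On `X ≥ t`, the formula for `Y` puts `Y` in a
Borel set `B ⊆ Iio t` exactly when `τ` is there, so the independence of `τ` becomes the rectangle
identity `IsCausal` for the law of `(X, Y)`; conversely, a law with this identity is realised with
`τ = Y`. On the kernel side, the σ-field at time `t` does not separate points of `Ici t`, up to null
sets, so causality says that `Q x B` is a.e. constant there, which is the same identity
(`mem_causalPlans_iff`).

Attainment is the direct method: plans are tight, the cost is lower semicontinuous, and the identity
survives weak limits because fixed marginals force convergence on all Borel rectangles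
(`tendsto_measureReal_prod_of_transportPlans`). -/

/-- For a plan `γ` with first marginal `η`: given that the first coordinate lies beyond `t`, its
position there is independent of the restriction of the second coordinate to the time before `t`. -/
def IsCausal (η : Measure ℝ) (γ : Measure (ℝ × ℝ)) : Prop :=
  ∀ (t : ℝ) (A B : Set ℝ), MeasurableSet A → MeasurableSet B → A ⊆ Ici t → B ⊆ Iio t →
    γ (A ×ˢ B) * η (Ici t) = η A * γ (Ici t ×ˢ B)

/-! ### Measurability for the completed σ-fields -/

theorem mem_negligibleSets_of_measure_eq_zero {η : Measure ℝ} {N : Set ℝ} (hN : η N = 0) :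
    N ∈ negligibleSets η :=
  ⟨toMeasurable η N, measurableSet_toMeasurable η N, subset_toMeasurable η N, by
    rwa [measure_toMeasurable]⟩

theorem completedBy_eq_eventuallyMeasurableSpace (η : Measure ℝ) (m : MeasurableSpace ℝ) :
    completedBy η m = eventuallyMeasurableSpace m (ae η) := by
  apply le_antisymm
  · refine sup_le le_eventuallyMeasurableSpace (MeasurableSpace.generateFrom_le ?_)
    rintro N ⟨A, -, hNA, hA⟩
    exact ⟨∅, MeasurableSet.empty, ae_eq_empty.2 (measure_mono_null hNA hA)⟩
  · rintro S ⟨T, hT, hST⟩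
    have hneg : ∀ N : Set ℝ, η N = 0 → MeasurableSet[completedBy η m] N := fun N hN =>
      (le_sup_right : _ ≤ completedBy η m) _ (MeasurableSpace.measurableSet_generateFrom
        (mem_negligibleSets_of_measure_eq_zero hN))
    have hT' : MeasurableSet[completedBy η m] T := (le_sup_left : _ ≤ completedBy η m) _ hT
    have h1 := hneg _ (ae_le_set.1 hST.le)
    have h2 := hneg _ (ae_le_set.1 hST.symm.le)
    have : S = (T \ (T \ S)) ∪ (S \ T) := by
      ext x; simp only [mem_union, Set.mem_sdiff]; tauto
    rw [this]
    exact (hT'.diff h2).union h1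

/-- A function measurable for the completion of `borelBefore t` is a.e. constant beyond `t`. -/
theorem exists_ae_eq_const_of_measurable_completedBy {η : Measure ℝ} {t : ℝ} {f : ℝ → ENNReal}
    (hf : Measurable[completedBy η (borelBefore t)] f) :
    ∃ k, ∀ᵐ x ∂η.restrict (Ici t), f x = k := by
  -- Each preimage is a.e. equal to a set that misses or contains `Ici t`; countably many measurable
  -- sets separate the values.
  refine exists_eventuallyEq_const_of_forall_separating MeasurableSet fun U hU => ?_
  have hS := hf hU
  rw [completedBy_eq_eventuallyMeasurableSpace] at hS
  obtain ⟨T, ⟨-, hT | hT⟩, hST⟩ := hS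
  · refine Or.inr ?_
    rw [ae_restrict_iff' measurableSet_Ici]
    filter_upwards [hST.mem_iff] with x hx hxt hxU
    exact not_lt.2 (mem_Ici.1 hxt) (hT (hx.1 hxU))
  · refine Or.inl ?_
    rw [ae_restrict_iff' measurableSet_Ici]
    filter_upwards [hST.mem_iff] with x hx hxt
    exact hx.2 (hT hxt)

/-- A Borel function that is a.e. constant beyond `t` is measurable for the completion of
`borelBefore t`. -/
theorem measurable_completedBy_of_ae_eq_const {η : Measure ℝ} {t : ℝ} {f : ℝ → ENNReal}
    (hf : Measurable f) {k : ENNReal} (hk : ∀ᵐ x ∂η.restrict (Ici t), f x = k) :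
    Measurable[completedBy η (borelBefore t)] f := by
  rw [completedBy_eq_eventuallyMeasurableSpace]
  rw [ae_restrict_iff' measurableSet_Ici] at hk
  intro U hU
  by_cases hkU : k ∈ U
  · refine ⟨f ⁻¹' U ∪ Ici t, ⟨(hf hU).union measurableSet_Ici, Or.inr subset_union_right⟩, ?_⟩
    filter_upwards [hk] with x hx
    refine propext ⟨fun h => Or.inl h, fun h => h.elim id fun h => ?_⟩
    show f x ∈ U
    rwa [hx h]
  · refine ⟨f ⁻¹' U ∩ Iio t, ⟨(hf hU).inter measurableSet_Iio, Or.inl inter_subset_right⟩, ?_⟩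
    filter_upwards [hk] with x hx
    refine propext ⟨fun h => ⟨h, ?_⟩, fun h => h.1⟩
    by_contra hxt
    have h' : f x ∈ U := h
    exact hkU (hx (mem_Ici.2 (not_lt.1 hxt)) ▸ h')

/-! ### Causality as a rectangle identity -/

theorem dense_setOf_measure_singleton_eq_zero (ν : Measure ℝ) [SFinite ν] :
    Dense {s : ℝ | ν {s} = 0} := by
  have h : {s : ℝ | 0 < ν {s}}.Countable :=
    Measure.countable_meas_pos_of_disjoint_iUnion (fun s => measurableSet_singleton s)
      fun a b hab => by simpa [Function.onFun] using hab
  have := h.dense_compl ℝ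
  convert this using 1
  ext s
  simp

/-- It suffices to check causality on the half-lines that end in continuity points of a measure. -/
theorem isCausal_of_Iio {η ν : Measure ℝ} [IsFiniteMeasure η] [SFinite ν] {γ : Measure (ℝ × ℝ)}
    [IsFiniteMeasure γ]
    (h : ∀ s t : ℝ, ν {s} = 0 → s < t → ∀ A : Set ℝ, MeasurableSet A → A ⊆ Ici t →
      γ (A ×ˢ Iio s) * η (Ici t) = η A * γ (Ici t ×ˢ Iio s)) : IsCausal η γ := by
  intro t A B hA hB hAt hBt
  have hle : ∀ s ≤ t, γ (A ×ˢ Iio s) * η (Ici t) = η A * γ (Ici t ×ˢ Iio s) := by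
    intro s hst
    -- Continuity points increasing strictly to `s` stay below `t` even for `s = t`; continuity from
    -- below gives the limit.
    obtain ⟨u, hu, hmem, hlim⟩ :=
      (dense_setOf_measure_singleton_eq_zero ν).exists_seq_strictMono_tendsto s
    have hU : ⋃ n, Iio (u n) = Iio s := by
      ext x
      simp only [mem_iUnion, mem_Iio]
      refine ⟨fun ⟨n, hn⟩ => hn.trans (hmem n).1, fun hx => ?_⟩
      exact (hlim.eventually_const_lt hx).exists
    have hconv : ∀ C : Set ℝ, Tendsto (fun n => γ (C ×ˢ Iio (u n))) atTop (𝓝 (γ (C ×ˢ Iio s))) := by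
      intro C
      rw [← hU, prod_iUnion]
      exact tendsto_measure_iUnion_atTop fun m n hmn =>
        prod_mono_right (Iio_subset_Iio (hu.monotone hmn))
    refine tendsto_nhds_unique_of_eventuallyEq
      (ENNReal.Tendsto.mul_const (hconv A) (Or.inr (measure_ne_top _ _)))
      (ENNReal.Tendsto.const_mul (hconv (Ici t)) (Or.inr (measure_ne_top _ _))) (.of_forall ?_)
    intro n
    exact h _ _ (hmem n).2 ((hmem n).1.trans_le hst) A hA hAt
  -- Both sides of the identity, as functions of `B`, are measures carried by `Iio t`; the π-system
  -- of half-lines determines them.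
  let m (c : ENNReal) (C : Set ℝ) : Measure ℝ := c • (γ.restrict (C ×ˢ Iio t)).map Prod.snd
  have hm : ∀ c C D, MeasurableSet D → m c C D = c * γ (C ×ˢ (D ∩ Iio t)) := by
    intro c C D hD
    simp only [m, Measure.smul_apply, smul_eq_mul]
    rw [Measure.map_apply measurable_snd hD, Measure.restrict_apply (measurable_snd hD)]
    congr 2
    ext ⟨x, y⟩
    simp only [mem_inter_iff, mem_preimage, mem_prod]
    tauto
  have hfin : IsFiniteMeasure (m (η (Ici t)) A) :=
    ⟨by rw [hm _ _ _ .univ]; exact ENNReal.mul_lt_top (measure_lt_top _ _) (measure_lt_top _ _)⟩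
  have hIio : ∀ s, m (η (Ici t)) A (Iio s) = m (η A) (Ici t) (Iio s) := by
    intro s
    rw [hm _ _ _ measurableSet_Iio, hm _ _ _ measurableSet_Iio, Iio_inter_Iio, mul_comm]
    exact hle _ (min_le_right _ _)
  have heq : m (η (Ici t)) A = m (η A) (Ici t) := by
    refine ext_of_generate_finite (range Iio) ?_ isPiSystem_Iio ?_ ?_
    · rw [BorelSpace.measurable_eq (α := ℝ)]
      exact borel_eq_generateFrom_Iio ℝ
    · rintro _ ⟨s, rfl⟩
      exact hIio s
    · rw [hm _ _ _ .univ, hm _ _ _ .univ, univ_inter, mul_comm]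
      exact hle t le_rfl
  have := congrArg (fun μ => μ B) heq
  simp only [hm _ _ _ hB, inter_eq_left.2 hBt] at this
  rwa [mul_comm]

/-- For `s < t` with `ν {s} = 0`, the half-line `Iio s` is an admissible test set at time `t`, so
its kernel mass is a.e. a constant `k` beyond `t`, and integrating gives `γ (C ×ˢ Iio s) = k * η C`.
-/
theorem isCausal_of_mem_causalPlans {η ν : Measure ℝ} [IsFiniteMeasure η] [SFinite ν]
    {γ : Measure (ℝ × ℝ)} (hγ : γ ∈ causalPlans η ν) : IsCausal η γ := by
  obtain ⟨⟨hprob, -, -⟩, Q, ⟨-, hQγ⟩, hcausal⟩ := hγ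
  refine isCausal_of_Iio (ν := ν) fun s t hs hst A hA hAt => ?_
  have hmeas : Measurable[completedBy η (borelBefore t)] (fun x => Q x (Iio s)) := by
    refine measurable_iff_comap_le.2 (le_trans ?_ (hcausal t))
    refine le_trans ?_ le_sup_left
    refine le_iSup₂_of_le (Iio s) ⟨⟨measurableSet_Iio, Or.inl (Iio_subset_Iio hst.le)⟩, ?_⟩ le_rfl
    rwa [frontier_Iio]
  obtain ⟨k, hk⟩ := exists_ae_eq_const_of_measurable_completedBy hmeas
  have hconst : ∀ C ⊆ Ici t, MeasurableSet C → γ (C ×ˢ Iio s) = k * η C := by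
    intro C hC hCm
    rw [hQγ _ _ hCm measurableSet_Iio,
      lintegral_congr_ae (ae_restrict_of_ae_restrict_of_subset hC hk), setLIntegral_const]
  rw [hconst A hAt hA, hconst _ subset_rfl measurableSet_Ici]
  ring

theorem mem_causalPlans_of_isCausal {η ν : Measure ℝ} [IsFiniteMeasure η]
    {γ : Measure (ℝ × ℝ)} (hγ : γ ∈ transportPlans η ν) (hc : IsCausal η γ) :
    γ ∈ causalPlans η ν := by
  obtain ⟨hprob, hfst, -⟩ := id hγ
  have hfst' : γ.fst = η := hfst
  have hQ : IsTransportKernel η γ γ.condKernel := by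
    refine ⟨inferInstance, fun A B hA hB => ?_⟩
    conv_lhs => rw [← γ.disintegrate γ.condKernel]
    rw [Measure.compProd_apply_prod hA hB, hfst']
  refine ⟨hγ, γ.condKernel, hQ, fun t => sup_le (iSup₂_le fun B hB => ?_) le_sup_right⟩
  rw [← measurable_iff_comap_le]
  have key : ∀ B : Set ℝ, MeasurableSet B → B ⊆ Iio t →
      ∃ k, ∀ᵐ x ∂η.restrict (Ici t), γ.condKernel x B = k := by
    intro B hBm hB
    -- The constant can only be the conditional probability of `B` given that the first coordinate
    -- lies beyond `t`.
    refine ⟨γ (Ici t ×ˢ B) / η (Ici t), ?_⟩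
    rcases eq_or_ne (η (Ici t)) 0 with h0 | h0
    · rw [Measure.restrict_eq_zero.2 h0]; simp
    · refine ae_eq_of_forall_setLIntegral_eq_of_sigmaFinite
        (γ.condKernel.measurable_coe hBm) measurable_const fun A hA _ => ?_
      rw [Measure.restrict_restrict hA, ← hQ.2 _ _ (hA.inter measurableSet_Ici) hBm,
        setLIntegral_const]
      have := hc t (A ∩ Ici t) B (hA.inter measurableSet_Ici) hBm inter_subset_right hB
      rw [← ENNReal.mul_div_right_comm, mul_comm (γ _), ← this,
        ENNReal.mul_div_cancel_right h0 (measure_ne_top _ _)]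
  obtain ⟨⟨hBm, hB | hB⟩, -⟩ := hB
  · obtain ⟨k, hk⟩ := key B hBm hB
    exact measurable_completedBy_of_ae_eq_const (γ.condKernel.measurable_coe hBm) hk
  · obtain ⟨k, hk⟩ := key Bᶜ hBm.compl (by rwa [← compl_Ici, compl_subset_compl])
    refine measurable_completedBy_of_ae_eq_const (k := 1 - k) (γ.condKernel.measurable_coe hBm) ?_
    filter_upwards [hk] with x hx
    rw [← hx, ← prob_compl_eq_one_sub hBm.compl, compl_compl]

theorem mem_causalPlans_iff {η ν : Measure ℝ} [IsFiniteMeasure η] [SFinite ν]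
    {γ : Measure (ℝ × ℝ)} : γ ∈ causalPlans η ν ↔ γ ∈ transportPlans η ν ∧ IsCausal η γ :=
  ⟨fun h => ⟨h.1, isCausal_of_mem_causalPlans h⟩, fun h => mem_causalPlans_of_isCausal h.1 h.2⟩

/-! ### Weak limits of transport plans -/

/-- Layer cake: superlevel sets are open, so the portmanteau bound holds at each level, and Fatou
integrates it. -/
theorem lintegral_le_liminf_of_lowerSemicontinuous {E : Type*} [TopologicalSpace E]
    [MeasurableSpace E] [BorelSpace E] [HasOuterApproxClosed E] {f : E → ℝ}
    (hf : LowerSemicontinuous f) (hf0 : ∀ x, 0 ≤ f x) {μs : ℕ → ProbabilityMeasure E}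
    {μ : ProbabilityMeasure E} (h : Tendsto μs atTop (𝓝 μ)) :
    ∫⁻ x, ENNReal.ofReal (f x) ∂(μ : Measure E) ≤
      liminf (fun n => ∫⁻ x, ENNReal.ofReal (f x) ∂(μs n : Measure E)) atTop := by
  simp_rw [lintegral_eq_lintegral_meas_lt _ (Eventually.of_forall hf0) hf.measurable.aemeasurable]
  calc ∫⁻ t in Ioi (0 : ℝ), (μ : Measure E) {a | t < f a}
      ≤ ∫⁻ t in Ioi (0 : ℝ), liminf (fun n => (μs n : Measure E) {a | t < f a}) atTop :=
        lintegral_mono fun t =>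
          ProbabilityMeasure.le_liminf_measure_open_of_tendsto h (hf.isOpen_preimage t)
    _ ≤ _ := lintegral_liminf_le fun n => Antitone.measurable fun s t hst =>
        measure_mono fun _ hω => lt_of_le_of_lt hst hω

theorem transportPlans_measureReal_add_compl {η ν : Measure ℝ} {γ : Measure (ℝ × ℝ)}
    (hγ : γ ∈ transportPlans η ν) {A B : Set ℝ} (hA : MeasurableSet A) (hB : MeasurableSet B) :
    γ.real (A ×ˢ B) + γ.real (Aᶜ ×ˢ B) = ν.real B := by
  obtain ⟨hprob, -, hsnd⟩ := hγ
  rw [← hsnd, map_measureReal_apply measurable_snd hB, ← measureReal_union _ (hA.compl.prod hB)]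
  · congr 1
    ext ⟨x, y⟩
    by_cases x ∈ A <;> simp [*]
  · exact Disjoint.set_prod_left disjoint_compl_right _ _

/-- For plans with fixed marginals, weak convergence implies convergence on all Borel rectangles. -/
theorem tendsto_measureReal_prod_of_transportPlans {η ν : Measure ℝ} [IsFiniteMeasure η]
    [IsFiniteMeasure ν]
    {γs : ℕ → ProbabilityMeasure (ℝ × ℝ)} {γ : ProbabilityMeasure (ℝ × ℝ)}
    (h : Tendsto γs atTop (𝓝 γ)) (hγs : ∀ n, (γs n : Measure (ℝ × ℝ)) ∈ transportPlans η ν)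
    (hγ : (γ : Measure (ℝ × ℝ)) ∈ transportPlans η ν) {A B : Set ℝ} (hA : MeasurableSet A)
    (hB : MeasurableSet B) :
    Tendsto (fun n => (γs n : Measure (ℝ × ℝ)).real (A ×ˢ B)) atTop
      (𝓝 ((γ : Measure (ℝ × ℝ)).real (A ×ˢ B))) := by
  have lower : ∀ A B : Set ℝ, MeasurableSet A → MeasurableSet B → ∀ r : ℝ,
      r < (γ : Measure (ℝ × ℝ)).real (A ×ˢ B) →
      ∀ᶠ n in atTop, r < (γs n : Measure (ℝ × ℝ)).real (A ×ˢ B) := by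
    intro A B hA hB r hr
    rcases lt_or_ge r 0 with hr0 | hr0
    · exact .of_forall fun n => hr0.trans_le measureReal_nonneg
    -- Passing from `A ×ˢ B` to an open rectangle costs `ε` per marginal, uniformly in `n`; the
    -- third `ε` keeps the inequality strict.
    set ε := ((γ : Measure (ℝ × ℝ)).real (A ×ˢ B) - r) / 3 with hε
    have hε0 : 0 < ε := by linarith
    have approx : ∀ (μ : Measure ℝ) [IsFiniteMeasure μ] (C : Set ℝ), MeasurableSet C →
        ∃ U ⊇ C, IsOpen U ∧ μ.real (U \ C) ≤ ε := by
      intro μ _ C hC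
      obtain ⟨U, hCU, hU, -, hlt⟩ := hC.exists_isOpen_sdiff_lt (measure_ne_top μ C)
        (ENNReal.ofReal_pos.2 hε0).ne'
      exact ⟨U, hCU, hU, ENNReal.toReal_le_of_le_ofReal hε0.le hlt.le⟩
    obtain ⟨U, hAU, hU, hUε⟩ := approx η A hA
    obtain ⟨V, hBV, hV, hVε⟩ := approx ν B hB
    have hopen := ProbabilityMeasure.le_liminf_measure_open_of_tendsto h (hU.prod hV)
    have hlt : ENNReal.ofReal (r + 2 * ε) < (γ : Measure (ℝ × ℝ)) (U ×ˢ V) := by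
      refine lt_of_lt_of_le ?_ (measure_mono (prod_mono hAU hBV))
      rw [← ofReal_measureReal]
      exact (ENNReal.ofReal_lt_ofReal_iff (hr0.trans_lt hr)).2 (by linarith)
    filter_upwards [eventually_lt_of_lt_liminf (hlt.trans_le hopen)] with n hn
    obtain ⟨-, hfst, hsnd⟩ := hγs n
    have h1 : r + 2 * ε < (γs n : Measure (ℝ × ℝ)).real (U ×ˢ V) := by
      rw [← ofReal_measureReal] at hn
      exact (ENNReal.ofReal_lt_ofReal_iff').1 hn |>.1
    have h2 : (γs n : Measure (ℝ × ℝ)).real (U ×ˢ V) ≤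
        (γs n : Measure (ℝ × ℝ)).real (A ×ˢ B) + η.real (U \ A) + ν.real (V \ B) := by
      rw [← hfst, ← hsnd, map_measureReal_apply measurable_fst (hU.measurableSet.diff hA),
        map_measureReal_apply measurable_snd (hV.measurableSet.diff hB)]
      refine (measureReal_mono ?_).trans ((measureReal_union_le _ _).trans
        (add_le_add_left (measureReal_union_le _ _) _))
      rintro ⟨x, y⟩ ⟨hx, hy⟩
      by_cases hxA : x ∈ A
      · by_cases hyB : y ∈ B
        · exact Or.inl (Or.inl ⟨hxA, hyB⟩)
        · exact Or.inr ⟨hy, hyB⟩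
      · exact Or.inl (Or.inr ⟨hx, hxA⟩)
    linarith
  refine tendsto_order.2 ⟨fun r hr => lower A B hA hB r hr, fun r hr => ?_⟩
  -- The two masses add up to `ν.real B`, so a lower bound on `Aᶜ ×ˢ B` is an upper bound on `A ×ˢ
  -- B`.
  have hadd := transportPlans_measureReal_add_compl hγ hA hB
  filter_upwards [lower Aᶜ B hA.compl hB (ν.real B - r) (by linarith)] with n hn
  have := transportPlans_measureReal_add_compl (hγs n) hA hB
  linarith

theorem isTightMeasureSet_transportPlans (η ν : Measure ℝ) [IsFiniteMeasure η] [IsFiniteMeasure ν] :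
    IsTightMeasureSet (transportPlans η ν) := by
  refine .prodMk (.subset (isTightMeasureSet_singleton (μ := η)) ?_)
    (.subset (isTightMeasureSet_singleton (μ := ν)) ?_)
  · rintro _ ⟨γ, hγ, rfl⟩
    exact hγ.2.1
  · rintro _ ⟨γ, hγ, rfl⟩
    exact hγ.2.2

theorem transportPlans_of_tendsto {η ν : Measure ℝ}
    {γs : ℕ → ProbabilityMeasure (ℝ × ℝ)} {γ : ProbabilityMeasure (ℝ × ℝ)}
    (h : Tendsto γs atTop (𝓝 γ)) (hγs : ∀ n, (γs n : Measure (ℝ × ℝ)) ∈ transportPlans η ν) :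
    (γ : Measure (ℝ × ℝ)) ∈ transportPlans η ν := by
  have key : ∀ f : ℝ × ℝ → ℝ, Continuous f → ∀ μ : Measure ℝ,
      (∀ n, (γs n : Measure (ℝ × ℝ)).map f = μ) → (γ : Measure (ℝ × ℝ)).map f = μ := by
    intro f hf μ hμ
    have h1 := ProbabilityMeasure.tendsto_map_of_tendsto_of_continuous γs γ h hf
    have h2 : ∀ n, (γs n).map hf.measurable.aemeasurable = (γs 0).map hf.measurable.aemeasurable :=
      fun n => Subtype.ext ((hμ n).trans (hμ 0).symm)
    simp_rw [h2] at h1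
    have := congrArg (fun p : ProbabilityMeasure ℝ => (p : Measure ℝ))
      (tendsto_nhds_unique h1 tendsto_const_nhds)
    exact this.trans (hμ 0)
  exact ⟨inferInstance, key _ continuous_fst _ fun n => (hγs n).2.1,
    key _ continuous_snd _ fun n => (hγs n).2.2⟩

/-! ### Adapted couplings and their joint laws -/

theorem cond_inter_eq_mul_iff {Ω : Type*} [MeasurableSpace Ω] {P : Measure Ω} [IsFiniteMeasure P]
    {S T U : Set Ω} (hS : MeasurableSet S) (h0 : P S ≠ 0) (hUS : U ⊆ S) :
    cond P S (T ∩ U) = cond P S T * cond P S U ↔ P (U ∩ T) * P S = P U * P (S ∩ T) := by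
  have htop := measure_ne_top P S
  rw [cond_apply hS, cond_apply hS, cond_apply hS, inter_comm T U, ← inter_assoc,
    inter_eq_right.2 hUS, mul_mul_mul_comm, mul_assoc, ENNReal.mul_right_inj
      (ENNReal.inv_ne_zero.2 htop) (ENNReal.inv_ne_top.2 h0), mul_comm (P (S ∩ T)),
    ← ENNReal.div_eq_inv_mul, ENNReal.eq_div_iff h0 htop, mul_comm (P S)]

/-- On the event that `X` lies beyond `t`, the variable `Y` lies before `t` exactly when the waiting
time does. -/
theorem IsAdaptedCoupling.measure_eq {Ω : Type*} [MeasurableSpace Ω] {P : Measure Ω}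
    {X Y τ Z : Ω → ℝ}
    (hY : ∀ᵐ ω ∂P, Y ω =
      {ω | X ω ≤ τ ω}.indicator (fun ω => X ω + Z ω) ω + {ω | τ ω < X ω}.indicator τ ω)
    (hZ : ∀ᵐ ω ∂P, 0 ≤ Z ω) {t : ℝ} {A B : Set ℝ} (hA : A ⊆ Ici t) (hB : B ⊆ Iio t) :
    P (X ⁻¹' A ∩ Y ⁻¹' B) = P (X ⁻¹' A ∩ τ ⁻¹' B) := by
  refine measure_congr ?_
  filter_upwards [hY, hZ] with ω hω hz
  refine propext (and_congr_right fun hXA => ?_)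
  have hXt : t ≤ X ω := hA hXA
  show Y ω ∈ B ↔ τ ω ∈ B
  -- If `X ≤ τ`, then `τ` and `Y = X + Z` are both at least `t`, hence outside `B`; otherwise they
  -- coincide.
  rcases le_or_gt (X ω) (τ ω) with h | h
  · have hYω : Y ω = X ω + Z ω := by
      simpa [indicator, h, not_lt.2 h] using hω
    constructor
    · intro hb
      have := mem_Iio.1 (hB hb)
      linarith
    · intro hb
      have := mem_Iio.1 (hB hb)
      linarith
  · have hYω : Y ω = τ ω := by
      simpa [indicator, h, not_le.2 h] using hω
    rw [hYω]

namespace AdaptedCoupling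

variable {η ν : Measure ℝ}

theorem measurable_X (C : AdaptedCoupling.{u} η ν) : Measurable C.X := C.isAdaptedCoupling.1

theorem measurable_Y (C : AdaptedCoupling.{u} η ν) : Measurable C.Y := C.isAdaptedCoupling.2.1

theorem jointLaw_mem_transportPlans (C : AdaptedCoupling.{u} η ν) :
    C.jointLaw ∈ transportPlans η ν := by
  have hXY := C.measurable_X.prodMk C.measurable_Y
  refine ⟨Measure.isProbabilityMeasure_map hXY.aemeasurable, ?_, ?_⟩
  · rw [jointLaw, Measure.map_map measurable_fst hXY]
    exact C.law_X
  · rw [jointLaw, Measure.map_map measurable_snd hXY]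
    exact C.law_Y

theorem jointLaw_prod (C : AdaptedCoupling.{u} η ν) {A B : Set ℝ} (hA : MeasurableSet A)
    (hB : MeasurableSet B) : C.jointLaw (A ×ˢ B) = C.P (C.X ⁻¹' A ∩ C.Y ⁻¹' B) := by
  rw [jointLaw, Measure.map_apply (C.measurable_X.prodMk C.measurable_Y) (hA.prod hB)]
  rfl

theorem isCausal_jointLaw (C : AdaptedCoupling.{u} η ν) : IsCausal η C.jointLaw := by
  intro t A B hA hB hAt hBt
  obtain ⟨-, -, τ, Z, hτ, -, hY, hZ, hind⟩ := C.isAdaptedCoupling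
  have hη : ∀ D, MeasurableSet D → η D = C.P (C.X ⁻¹' D) := fun D hD => by
    conv_lhs => rw [← C.law_X]
    rw [Measure.map_apply C.measurable_X hD]
  rw [C.jointLaw_prod hA hB, C.jointLaw_prod measurableSet_Ici hB, hη A hA, hη _ measurableSet_Ici,
    IsAdaptedCoupling.measure_eq hY hZ hAt hBt,
    IsAdaptedCoupling.measure_eq hY hZ subset_rfl hBt]
  rcases eq_or_ne (C.P (C.X ⁻¹' Ici t)) 0 with h0 | h0
  · rw [h0, measure_mono_null (preimage_mono hAt) h0, mul_zero, zero_mul]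
  · exact (cond_inter_eq_mul_iff (C.measurable_X measurableSet_Ici) h0 (preimage_mono hAt)).1
      (hind t (pos_iff_ne_zero.2 h0) B A hB hA hBt hAt)

theorem jointLaw_mem_causalPlans [IsFiniteMeasure η] (C : AdaptedCoupling.{u} η ν) :
    C.jointLaw ∈ causalPlans η ν :=
  mem_causalPlans_of_isCausal C.jointLaw_mem_transportPlans C.isCausal_jointLaw

theorem cost_eq_lintegral_jointLaw (C : AdaptedCoupling.{u} η ν) {c : ℝ × ℝ → ℝ}
    (hc : Measurable c) : C.cost c = ∫⁻ p, ENNReal.ofReal (c p) ∂C.jointLaw := by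
  rw [jointLaw, lintegral_map hc.ennreal_ofReal (C.measurable_X.prodMk C.measurable_Y)]
  rfl

end AdaptedCoupling

/-- For a causal plan, the coordinates form an adapted coupling with waiting time `Y`. -/
theorem isAdaptedCoupling_of_isCausal {Ω : Type*} [MeasurableSpace Ω] {P : Measure Ω}
    [IsFiniteMeasure P] {X Y : Ω → ℝ} (hX : Measurable X) (hY : Measurable Y)
    (h : IsCausal (P.map X) (P.map fun ω => (X ω, Y ω))) : IsAdaptedCoupling P X Y := by
  -- With `τ = Y`, the delay `(Y - X)⁺` restores `Y` on `X ≤ Y`.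
  refine ⟨hX, hY, Y, fun ω => max (Y ω - X ω) 0, hY, (hY.sub hX).max measurable_const, ?_,
    .of_forall fun ω => le_max_right _ _, ?_⟩
  · refine .of_forall fun ω => ?_
    rcases le_or_gt (X ω) (Y ω) with hω | hω
    · simp [indicator, hω, not_lt.2 hω]
    · simp [indicator, hω, not_le.2 hω]
  · intro t ht A B hA hB hAt hBt
    have := h t B A hB hA hBt hAt
    rw [Measure.map_apply hX hB, Measure.map_apply hX measurableSet_Ici,
      Measure.map_apply (hX.prodMk hY) (hB.prod hA),
      Measure.map_apply (hX.prodMk hY) (measurableSet_Ici.prod hA)] at this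
    exact (cond_inter_eq_mul_iff (hX measurableSet_Ici) ht.ne' (preimage_mono hBt)).2 this

/-- The coordinates on the plane carrying `γ` suffice: `ULift` moves it to universe `u`, and
completing the measure leaves the law unchanged. -/
theorem exists_adaptedCoupling_jointLaw_eq {η ν : Measure ℝ} [IsFiniteMeasure η] [SFinite ν]
    {γ : Measure (ℝ × ℝ)} (hγ : γ ∈ causalPlans η ν) :
    ∃ C : AdaptedCoupling.{u} η ν, C.jointLaw = γ := by
  obtain ⟨⟨hprob, hfst, hsnd⟩, hcausal⟩ := mem_causalPlans_iff.1 hγ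
  let P₀ : Measure (ULift.{u} (ℝ × ℝ)) := γ.map ULift.up
  have hP₀ : IsProbabilityMeasure P₀ :=
    Measure.isProbabilityMeasure_map measurable_up.aemeasurable
  let P : Measure (NullMeasurableSpace (ULift.{u} (ℝ × ℝ)) P₀) := P₀.completion
  have hP : IsProbabilityMeasure P := ⟨hP₀.measure_univ⟩
  let down : NullMeasurableSpace (ULift.{u} (ℝ × ℝ)) P₀ → ℝ × ℝ := ULift.down
  have hdown : Measurable down := fun s hs => (measurable_down hs).nullMeasurableSet
  have hmap : P.map down = γ := by
    refine Measure.ext fun s hs => ?_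
    rw [Measure.map_apply hdown hs]
    exact (Measure.completion_apply P₀ _).trans <| Measure.map_apply measurable_up (measurable_down hs)
  have hX : P.map (fun ω => (down ω).1) = η := by
    rw [← hfst, ← hmap, Measure.map_map measurable_fst hdown]
    rfl
  have hY : P.map (fun ω => (down ω).2) = ν := by
    rw [← hsnd, ← hmap, Measure.map_map measurable_snd hdown]
    rfl
  have hXY : P.map (fun ω => ((down ω).1, (down ω).2)) = γ := hmap
  refine ⟨{ Ω := NullMeasurableSpace (ULift.{u} (ℝ × ℝ)) P₀
            P := P
            isProbabilityMeasure := hP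
            isComplete := Measure.completion.isComplete P₀
            X := fun ω => (down ω).1
            Y := fun ω => (down ω).2
            isAdaptedCoupling := isAdaptedCoupling_of_isCausal hdown.fst hdown.snd ?_
            law_X := hX
            law_Y := hY }, hXY⟩
  rwa [hX, hXY]

/-! ### Existence of minimisers and equivalence -/

theorem prod_mem_causalPlans (η ν : Measure ℝ) [IsProbabilityMeasure η] [IsProbabilityMeasure ν] :
    η.prod ν ∈ causalPlans η ν := by
  refine mem_causalPlans_of_isCausal ⟨inferInstance, ?_, ?_⟩ fun t A B _ _ _ _ => ?_
  · simp
  · simp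
  · rw [Measure.prod_prod, Measure.prod_prod]
    ring

theorem exists_isMinOn_lintegral_causalPlans {c : ℝ × ℝ → ℝ} (hc_nonneg : ∀ p, 0 ≤ c p)
    (hc : LowerSemicontinuous c) (η ν : Measure ℝ) [IsProbabilityMeasure η]
    [IsProbabilityMeasure ν] :
    ∃ γ ∈ causalPlans η ν, IsMinOn (fun γ => ∫⁻ p, ENNReal.ofReal (c p) ∂γ) (causalPlans η ν) γ := by
  set F : Measure (ℝ × ℝ) → ENNReal := fun γ => ∫⁻ p, ENNReal.ofReal (c p) ∂γ with hF
  obtain ⟨u, -, hu, hmem⟩ := exists_seq_tendsto_sInf (S := F '' causalPlans η ν)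
    ⟨_, mem_image_of_mem F (prod_mem_causalPlans η ν)⟩ (OrderBot.bddBelow _)
  choose γs hγs hγu using hmem
  let Γ : ℕ → ProbabilityMeasure (ℝ × ℝ) := fun n => ⟨γs n, (hγs n).1.1⟩
  have hcompact : IsCompact (closure {γ : ProbabilityMeasure (ℝ × ℝ) |
      (γ : Measure (ℝ × ℝ)) ∈ transportPlans η ν}) := by
    refine isCompact_closure_of_isTightMeasureSet
      ((isTightMeasureSet_transportPlans η ν).subset ?_)
    rintro _ ⟨γ, hγ, rfl⟩
    exact hγ
  obtain ⟨γ, -, φ, hφ, hlim⟩ :=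
    hcompact.isSeqCompact (x := Γ) fun n => subset_closure (hγs n).1
  have hplans : ∀ n, ((Γ ∘ φ) n : Measure (ℝ × ℝ)) ∈ transportPlans η ν := fun n => (hγs (φ n)).1
  have hγ := transportPlans_of_tendsto hlim hplans
  -- Each side of the identity converges along the subsequence, even for rectangles whose boundary
  -- has mass.
  have hcausal : IsCausal η γ := by
    intro t A B hA hB hAt hBt
    have h1 := (tendsto_measureReal_prod_of_transportPlans hlim hplans hγ hA hB).mul_const
      (η.real (Ici t))
    have h2 := (tendsto_measureReal_prod_of_transportPlans hlim hplans hγ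
      (measurableSet_Ici (a := t)) hB).const_mul (η.real A)
    have heq := tendsto_nhds_unique_of_eventuallyEq h1 h2 (.of_forall fun n => by
      have := congrArg ENNReal.toReal
        (isCausal_of_mem_causalPlans (hγs (φ n)) t A B hA hB hAt hBt)
      rwa [ENNReal.toReal_mul, ENNReal.toReal_mul] at this)
    refine (ENNReal.toReal_eq_toReal_iff' (ENNReal.mul_ne_top (measure_ne_top _ _)
      (measure_ne_top _ _)) (ENNReal.mul_ne_top (measure_ne_top _ _) (measure_ne_top _ _))).1 ?_
    rwa [ENNReal.toReal_mul, ENNReal.toReal_mul]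
  refine ⟨γ, mem_causalPlans_of_isCausal hγ hcausal, fun γ' hγ' => ?_⟩
  refine (lintegral_le_liminf_of_lowerSemicontinuous hc hc_nonneg hlim).trans ?_
  have hlimF : Tendsto (fun n => F (Γ (φ n) : Measure (ℝ × ℝ))) atTop
      (𝓝 (sInf (F '' causalPlans η ν))) := by
    have : (fun n => F (Γ (φ n) : Measure (ℝ × ℝ))) = u ∘ φ := funext fun n => hγu (φ n)
    rw [this]
    exact hu.comp hφ.tendsto_atTop
  exact hlimF.liminf_eq.trans_le (sInf_le (mem_image_of_mem F hγ'))

theorem corollary4p1 (c : ℝ × ℝ → ℝ) (hc_nonneg : ∀ p, 0 ≤ c p) (hc : LowerSemicontinuous c)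
    (η ν : Measure ℝ) [IsProbabilityMeasure η] [IsProbabilityMeasure ν] :
    -- the infimum over adapted couplings is attained
    (∃ C : AdaptedCoupling.{u} η ν, C.cost c = ⨅ C' : AdaptedCoupling.{u} η ν, C'.cost c) ∧
    -- both problems have the same value
    (⨅ C' : AdaptedCoupling.{u} η ν, C'.cost c) =
      (⨅ γ' ∈ causalPlans η ν, ∫⁻ p, ENNReal.ofReal (c p) ∂γ') ∧
    -- and the optimal causal plans are the joint laws of the optimal adapted couplings
    ∀ γ : Measure (ℝ × ℝ),
      (γ ∈ causalPlans η ν ∧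
        ∫⁻ p, ENNReal.ofReal (c p) ∂γ =
          ⨅ γ' ∈ causalPlans η ν, ∫⁻ p, ENNReal.ofReal (c p) ∂γ') ↔
      ∃ C : AdaptedCoupling.{u} η ν,
        C.cost c = (⨅ C' : AdaptedCoupling.{u} η ν, C'.cost c) ∧ γ = C.jointLaw := by
  have hcost : ∀ C : AdaptedCoupling.{u} η ν,
      C.cost c = ∫⁻ p, ENNReal.ofReal (c p) ∂C.jointLaw := fun C =>
    C.cost_eq_lintegral_jointLaw hc.measurable
  have hvalue : (⨅ C' : AdaptedCoupling.{u} η ν, C'.cost c) =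
      ⨅ γ' ∈ causalPlans η ν, ∫⁻ p, ENNReal.ofReal (c p) ∂γ' := by
    refine le_antisymm (le_iInf₂ fun γ hγ => ?_) (le_iInf fun C => ?_)
    · obtain ⟨C, rfl⟩ := exists_adaptedCoupling_jointLaw_eq.{u} hγ
      exact (iInf_le _ C).trans_eq (hcost C)
    · rw [hcost C]
      exact iInf₂_le C.jointLaw C.jointLaw_mem_causalPlans
  refine ⟨?_, hvalue, fun γ => ⟨?_, ?_⟩⟩
  · obtain ⟨γ, hγ, hmin⟩ := exists_isMinOn_lintegral_causalPlans hc_nonneg hc η ν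
    obtain ⟨C, rfl⟩ := exists_adaptedCoupling_jointLaw_eq.{u} hγ
    refine ⟨C, le_antisymm ?_ (iInf_le _ C)⟩
    rw [hvalue, hcost C]
    exact le_iInf₂ fun γ' hγ' => hmin hγ'
  · rintro ⟨hγ, heq⟩
    obtain ⟨C, rfl⟩ := exists_adaptedCoupling_jointLaw_eq.{u} hγ
    exact ⟨C, by rw [hcost C, heq, hvalue], rfl⟩
  · rintro ⟨C, heq, rfl⟩
    exact ⟨C.jointLaw_mem_causalPlans, by rw [← hcost C, heq, hvalue]⟩
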